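/- Let $K$ be a field and let $E=(E^0,E^1,r,s)$ be an arbitrary directed graph (with no restriction on the number of vertices or edges). Let $L=L_K(E)$ be its Leavitt path algebra, that is, the (not necessarily unital) associative $K$-algebra generated by pairwise orthogonal idempotents $v$ ($v\in E^0$) and elements $e,e^*$ ($e\in E^1$) subject to the relations 1. $s(e)e=e=e\,r(e)$ for all $e\in E^1$; 2. $r(e)e^*=e^*=e^*s(e)$ for all $e\in E^1$; 3. $e^*e=r(e)$, and $e^*f=0$ if $e\neq f$, for all $e,f\in E^1$; 4. $v=\sum_{s(e)=v}ee^*$ for every $v\in E^0$ with $0<|s^{-1}(v)|<\infty$. A left (right) $L$-module $M$ is called simple if $LM\neq 0$ (respectively $ML\ne 0$) and its only submodules are $0$ and $M$. A cycle in $E$ is a path $e_1\cdots e_n$ with $n\ge 1$, $r(e_n)=s(e_1)$ and $s(e_i)\neq s(e_j)$ for all $i\neq j$; two cycles are regarded as the same if one is a cyclic rotation of the other. Suppose that $L$ has at most countably many isomorphism classes of simple left modules, or at most countably many isomorphism classes of simple right modules. Then distinct cycles in $E$ are disjoint: any two cycles that are not cyclic rotations of each other have no vertex in common. -/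

import Mathlib

/-!  Leavitt path algebras.

A directed graph is a `Quiver` on a type `V` of vertices. An edge is an element `e` of
`Quiver.Total V`, with source `e.left` and range `e.right`. -/

universe u v w

namespace LeavittPath

section Algebra

variable (K : Type w) [Field K] (V : Type u) [Quiver.{v} V]

/-- The generators: a vertex `v`, an edge `e`, or a ghost edge `e^*`. -/
inductive Gen : Type (max u v) where
  | vertex (v : V) : Gen
  | edge (e : Quiver.Total V) : Gen
  | ghost (e : Quiver.Total V) : Gen

variable {V} in
/-- The set `s⁻¹(v)` of edges emitted by `v`. -/
def emitted (v : V) : Set (Quiver.Total V) := {e | e.left = v}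

/-- The generator `v` in the free unital algebra. -/
abbrev genV (v : V) : FreeAlgebra K (Gen V) := FreeAlgebra.ι K (Gen.vertex v)

/-- The generator `e` in the free unital algebra. -/
abbrev genE (e : Quiver.Total V) : FreeAlgebra K (Gen V) :=
  FreeAlgebra.ι K (Gen.edge e)

/-- The generator `e^*` in the free unital algebra. -/
abbrev genG (e : Quiver.Total V) : FreeAlgebra K (Gen V) :=
  FreeAlgebra.ι K (Gen.ghost e)

/-- The defining relations of the Leavitt path algebra. -/
inductive LeavittRel : FreeAlgebra K (Gen V) → FreeAlgebra K (Gen V) → Prop where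
  | vertex_idem (v : V) : LeavittRel (genV K V v * genV K V v) (genV K V v)
  | vertex_orth (v w : V) (h : v ≠ w) : LeavittRel (genV K V v * genV K V w) 0
  | source_edge (e : Quiver.Total V) :
      LeavittRel (genV K V e.left * genE K V e) (genE K V e)
  | edge_range (e : Quiver.Total V) :
      LeavittRel (genE K V e * genV K V e.right) (genE K V e)
  | range_ghost (e : Quiver.Total V) :
      LeavittRel (genV K V e.right * genG K V e) (genG K V e)
  | ghost_source (e : Quiver.Total V) :
      LeavittRel (genG K V e * genV K V e.left) (genG K V e)
  | ck1_same (e : Quiver.Total V) :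
      LeavittRel (genG K V e * genE K V e) (genV K V e.right)
  | ck1_diff (e f : Quiver.Total V) (h : e ≠ f) :
      LeavittRel (genG K V e * genE K V f) 0
  | ck2 (v : V) (hne : (emitted v).Nonempty) (hfin : (emitted v).Finite) :
      LeavittRel (genV K V v) (∑ e ∈ hfin.toFinset, genE K V e * genG K V e)

/-- The unital `K`-algebra with the above generators and relations. -/
abbrev UnitalAlgebra : Type (max u v w) := RingQuot (LeavittRel K V)

/-- The image of a generator. -/
def gen (x : Gen V) : UnitalAlgebra K V :=
  RingQuot.mkAlgHom K (LeavittRel K V) (FreeAlgebra.ι K x)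

/-- The Leavitt path algebra `L_K(E)`, the (in general non-unital) `K`-algebra presented by the
above generators and relations. No relation has a constant term, so the unital algebra with this
presentation is the unitization `K ⊕ L_K(E)`, in which `L_K(E)` is the non-unital subalgebra
generated by the generators. -/
def leavittPathAlgebra : NonUnitalSubalgebra K (UnitalAlgebra K V) :=
  NonUnitalAlgebra.adjoin K (Set.range (gen K V))

end Algebra

section Modules

/-- A simple left module over a ring `R`, possibly without unit: an abelian group `M` with an
action `R → End M` such that `R M ≠ 0` and `0` and `M` are the only submodules. Such a module is
cyclic (`M = R m`), so up to isomorphism all of them live in the universe of `R`. -/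
structure SimpleModule (R : Type w) [NonUnitalRing R] : Type (w + 1) where
  /-- The underlying abelian group. -/
  carrier : Type w
  [addCommGroup : AddCommGroup carrier]
  /-- The action of the ring. -/
  action : R →ₙ+* AddMonoid.End carrier
  action_ne_zero : ∃ (a : R) (m : carrier), action a m ≠ 0
  eq_bot_or_top : ∀ N : AddSubgroup carrier,
    (∀ (a : R), ∀ m ∈ N, action a m ∈ N) → N = ⊥ ∨ N = ⊤

attribute [instance] SimpleModule.addCommGroup

/-- Isomorphism of simple modules. -/
def SimpleModule.Iso {R : Type w} [NonUnitalRing R] (M N : SimpleModule R) : Prop :=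
  ∃ f : M.carrier ≃+ N.carrier,
    ∀ (a : R) (m : M.carrier), f (M.action a m) = N.action a (f m)

/-- Isomorphism as an equivalence relation on simple modules. -/
def SimpleModule.isoSetoid (R : Type w) [NonUnitalRing R] : Setoid (SimpleModule R) where
  r := SimpleModule.Iso
  iseqv :=
    { refl := fun M => ⟨AddEquiv.refl _, fun _ _ => rfl⟩
      symm := by
        rintro M N ⟨f, hf⟩
        refine ⟨f.symm, fun a m => ?_⟩
        rw [AddEquiv.symm_apply_eq, hf, AddEquiv.apply_symm_apply]
      trans := by
        rintro M N P ⟨f, hf⟩ ⟨g, hg⟩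
        exact ⟨f.trans g, fun a m => by simp [hf, hg]⟩ }

/-- There are at most countably many isomorphism classes of simple left `R`-modules. -/
def LeftCIRT (R : Type w) [NonUnitalRing R] : Prop :=
  Countable (Quotient (SimpleModule.isoSetoid R))

/-- There are at most countably many isomorphism classes of simple right `R`-modules,
a right `R`-module being a left module over the opposite ring. -/
def RightCIRT (R : Type w) [NonUnitalRing R] : Prop :=
  LeftCIRT Rᵐᵒᵖ

end Modules

section Cycles

variable {V : Type u} [Quiver.{v} V]

/-- `[e₁, …, eₙ]` is a path of positive length: `r(eᵢ) = s(eᵢ₊₁)` for all `i < n`. -/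
def IsPath (p : List (Quiver.Total V)) : Prop :=
  p ≠ [] ∧ p.IsChain (fun e f => e.right = f.left)

/-- A cycle: a path `e₁ … eₙ` with `r(eₙ) = s(e₁)` and `s(eᵢ) ≠ s(eⱼ)` for `i ≠ j`. -/
def IsCycle (p : List (Quiver.Total V)) : Prop :=
  IsPath p ∧ (∀ e ∈ p.getLast?, ∀ f ∈ p.head?, e.right = f.left) ∧
    (p.map (fun e => e.left)).Nodup

/-- The set of vertices on a path. -/
def vertices (p : List (Quiver.Total V)) : Set V :=
  {x | ∃ e ∈ p, x = e.left ∨ x = e.right}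

end Cycles

end LeavittPath

/-! Suppose two different cycles meet at a vertex `x`. Rotated to start at `x`, they become closed
paths `a ≠ b`, and `ab ≠ ba`, since a cycle returns to its base only at its end. The words `ab` and
`ba` have equal length, so each binary sequence spells an infinite path in them.

Each infinite path `p` yields a Chen module, with basis the infinite paths tail equivalent to `p`.
Ghost edges along a long prefix of one basis path kill any finite set of others. This gives both
simplicity (`eq_bot_or_top_of_genOp_mem`) and the fact that isomorphic Chen modules come from tail
equivalent paths (`tailEq_of_injective`).

A tail class contains only countably many of the paths spelled (`countable_tailEq_wordSeq`), so
there are uncountably many simple modules. The involution exchanging `e` and `e^*` turns the left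
action into a right one on the same space. -/

namespace LeavittPath

open Finsupp

/-! ### Infinite paths and tail equivalence -/

section Paths

variable {V : Type u} [Quiver.{v} V]

/-- A sequence of edges is an infinite path if each edge starts where the previous one ends. -/
def IsInfinitePath (p : ℕ → Quiver.Total V) : Prop :=
  ∀ n, (p n).right = (p (n + 1)).left

/-- Two sequences are tail equivalent if they agree after deleting finite prefixes. -/
def TailEq {α : Type*} (p q : ℕ → α) : Prop :=
  ∃ m n, ∀ k, p (m + k) = q (n + k)

theorem TailEq.refl {α : Type*} (p : ℕ → α) : TailEq p p := ⟨0, 0, fun _ => rfl⟩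

theorem TailEq.symm {α : Type*} {p q : ℕ → α} (h : TailEq p q) : TailEq q p := by
  obtain ⟨m, n, h⟩ := h
  exact ⟨n, m, fun k => (h k).symm⟩

theorem TailEq.trans {α : Type*} {p q r : ℕ → α} (h₁ : TailEq p q) (h₂ : TailEq q r) :
    TailEq p r := by
  obtain ⟨m, n, h₁⟩ := h₁
  obtain ⟨m', n', h₂⟩ := h₂
  refine ⟨m + m', n' + n, fun k => ?_⟩
  rw [add_assoc, h₁, ← add_assoc, add_comm n m', add_assoc, h₂, add_assoc]

/-- Prepend a term to a sequence. -/
def consSeq {α : Type*} (a : α) (p : ℕ → α) : ℕ → α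
  | 0 => a
  | n + 1 => p n

/-- The infinite paths that are tail equivalent to `p`. -/
abbrev TailClass (p : ℕ → Quiver.Total V) : Type (max u v) :=
  {q : ℕ → Quiver.Total V // IsInfinitePath q ∧ TailEq q p}

namespace TailClass

variable {p : ℕ → Quiver.Total V}

theorem ext {q q' : TailClass p} (h : ∀ n, q.1 n = q'.1 n) : q = q' :=
  Subtype.ext (funext h)

/-- Delete the first `n` edges. -/
def drop (n : ℕ) (q : TailClass p) : TailClass p :=
  ⟨fun i => q.1 (n + i), fun i => q.2.1 (n + i),
    TailEq.trans ⟨0, n, fun k => by rw [zero_add]⟩ q.2.2⟩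

/-- Prepend an edge. -/
def cons (e : Quiver.Total V) (q : TailClass p) (h : e.right = (q.1 0).left) : TailClass p :=
  ⟨consSeq e q.1, fun n => by cases n with
    | zero => exact h
    | succ n => exact q.2.1 n,
    TailEq.trans ⟨1, 0, fun k => by rw [add_comm, zero_add]; rfl⟩ q.2.2⟩

theorem drop_zero (q : TailClass p) : q.drop 0 = q :=
  ext fun n => congrArg q.1 (zero_add n)

theorem drop_drop (m n : ℕ) (q : TailClass p) : (q.drop m).drop n = q.drop (m + n) :=
  ext fun i => congrArg q.1 (add_assoc m n i).symm

theorem cons_apply_zero (e : Quiver.Total V) (q : TailClass p) (h : e.right = (q.1 0).left) :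
    (cons e q h).1 0 = e := rfl

theorem drop_cons (e : Quiver.Total V) (q : TailClass p) (h : e.right = (q.1 0).left) :
    (cons e q h).drop 1 = q :=
  ext fun n => by
    change consSeq e q.1 (1 + n) = _
    rw [add_comm]; rfl

theorem right_eq_left_drop (q : TailClass p) : (q.1 0).right = ((q.drop 1).1 0).left := q.2.1 0

theorem cons_drop (q : TailClass p) :
    cons (q.1 0) (q.drop 1) q.right_eq_left_drop = q :=
  ext fun n => by
    cases n with
    | zero => rfl
    | succ n => exact congrArg q.1 (add_comm 1 n)

theorem cons_drop' (q : TailClass p) (e : Quiver.Total V) (he : q.1 0 = e)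
    (h : e.right = ((q.drop 1).1 0).left) : cons e (q.drop 1) h = q := by
  subst he
  exact q.cons_drop

end TailClass

end Paths

/-! ### Chen modules: operators satisfying the Leavitt relations -/

section Operators

open scoped Classical

variable (K : Type w) [Field K] {V : Type u} [Quiver.{v} V]

/-- The space with basis the infinite paths tail equivalent to `p`. -/
abbrev ChenModule (p : ℕ → Quiver.Total V) : Type (max u v w) := TailClass p →₀ K

variable (p : ℕ → Quiver.Total V)

/-- The action of a vertex: keep the paths starting there. -/
noncomputable def vertexOp (x : V) : Module.End K (ChenModule K p) :=
  linearCombination K fun q : TailClass p => if (q.1 0).left = x then single q (1 : K) else 0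

/-- The action of an edge: prepend it where possible. -/
noncomputable def edgeOp (e : Quiver.Total V) : Module.End K (ChenModule K p) :=
  linearCombination K fun q : TailClass p =>
    if h : e.right = (q.1 0).left then single (q.cons e h) (1 : K) else 0

/-- The action of a ghost edge: delete the first edge if it is the given one. -/
noncomputable def ghostOp (e : Quiver.Total V) : Module.End K (ChenModule K p) :=
  linearCombination K fun q : TailClass p => if q.1 0 = e then single (q.drop 1) (1 : K) else 0

/-- The action of a generator. -/
noncomputable def genOp : Gen V → Module.End K (ChenModule K p)
  | .vertex x => vertexOp K p x
  | .edge e => edgeOp K p e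
  | .ghost e => ghostOp K p e

variable {p}

theorem vertexOp_single (x : V) (q : TailClass p) (k : K) :
    vertexOp K p x (single q k) = if (q.1 0).left = x then single q k else 0 := by
  rw [vertexOp, linearCombination_single]
  split_ifs <;> simp

theorem edgeOp_single (e : Quiver.Total V) (q : TailClass p) (k : K) :
    edgeOp K p e (single q k) =
      if h : e.right = (q.1 0).left then single (q.cons e h) k else 0 := by
  rw [edgeOp, linearCombination_single]
  split_ifs <;> simp

theorem ghostOp_single (e : Quiver.Total V) (q : TailClass p) (k : K) :
    ghostOp K p e (single q k) = if q.1 0 = e then single (q.drop 1) k else 0 := by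
  rw [ghostOp, linearCombination_single]
  split_ifs <;> simp

theorem end_ext {f g : Module.End K (ChenModule K p)}
    (h : ∀ (q : TailClass p) (k : K), f (single q k) = g (single q k)) : f = g :=
  Finsupp.lhom_ext' fun q => LinearMap.ext fun k => h q k

variable (p)

theorem vertexOp_mul_self (x : V) : vertexOp K p x * vertexOp K p x = vertexOp K p x :=
  end_ext K fun q k => by
    rw [Module.End.mul_apply, vertexOp_single]
    split_ifs with h <;> simp [vertexOp_single, h]

theorem vertexOp_mul_of_ne {x y : V} (hxy : x ≠ y) : vertexOp K p x * vertexOp K p y = 0 :=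
  end_ext K fun q k => by
    rw [Module.End.mul_apply, vertexOp_single]
    split_ifs with h
    · simp [vertexOp_single, h, hxy.symm]
    · simp

theorem vertexOp_mul_edgeOp (e : Quiver.Total V) :
    vertexOp K p e.left * edgeOp K p e = edgeOp K p e :=
  end_ext K fun q k => by
    rw [Module.End.mul_apply, edgeOp_single]
    split_ifs with h
    · rw [vertexOp_single, if_pos (congrArg _ (TailClass.cons_apply_zero e q h))]
    · simp

theorem edgeOp_mul_vertexOp (e : Quiver.Total V) :
    edgeOp K p e * vertexOp K p e.right = edgeOp K p e :=
  end_ext K fun q k => by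
    rw [Module.End.mul_apply, vertexOp_single]
    split_ifs with h
    · rfl
    · rw [edgeOp_single, dif_neg (Ne.symm h), map_zero]

theorem vertexOp_mul_ghostOp (e : Quiver.Total V) :
    vertexOp K p e.right * ghostOp K p e = ghostOp K p e :=
  end_ext K fun q k => by
    rw [Module.End.mul_apply, ghostOp_single]
    split_ifs with h
    · rw [vertexOp_single, if_pos]
      rw [← q.right_eq_left_drop, h]
    · simp

theorem ghostOp_mul_vertexOp (e : Quiver.Total V) :
    ghostOp K p e * vertexOp K p e.left = ghostOp K p e :=
  end_ext K fun q k => by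
    rw [Module.End.mul_apply, vertexOp_single]
    split_ifs with h
    · rfl
    · rw [ghostOp_single, if_neg (fun h' => h (by rw [h'])), map_zero]

theorem ghostOp_mul_edgeOp_self (e : Quiver.Total V) :
    ghostOp K p e * edgeOp K p e = vertexOp K p e.right :=
  end_ext K fun q k => by
    rw [Module.End.mul_apply, edgeOp_single, vertexOp_single]
    by_cases h : e.right = (q.1 0).left
    · rw [dif_pos h, if_pos h.symm, ghostOp_single,
        if_pos (TailClass.cons_apply_zero e q h), TailClass.drop_cons]
    · rw [dif_neg h, if_neg (Ne.symm h), map_zero]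

theorem ghostOp_mul_edgeOp_of_ne {e f : Quiver.Total V} (hef : e ≠ f) :
    ghostOp K p e * edgeOp K p f = 0 :=
  end_ext K fun q k => by
    rw [Module.End.mul_apply, edgeOp_single]
    split_ifs with h
    · rw [ghostOp_single, if_neg (fun h' => hef h'.symm), LinearMap.zero_apply]
    · simp

theorem edgeOp_mul_ghostOp_single (e : Quiver.Total V) (q : TailClass p) (k : K) :
    (edgeOp K p e * ghostOp K p e) (single q k) = if q.1 0 = e then single q k else 0 := by
  rw [Module.End.mul_apply, ghostOp_single]
  split_ifs with h
  · have h' : e.right = ((q.drop 1).1 0).left := by rw [← q.right_eq_left_drop, h]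
    rw [edgeOp_single, dif_pos h', q.cons_drop' e h]
  · simp

/-- Each `ee^*` projects onto the paths with first edge `e`, and an infinite path always has exactly
one first edge. -/
theorem sum_edgeOp_mul_ghostOp (x : V) (hfin : (emitted x).Finite) :
    ∑ e ∈ hfin.toFinset, edgeOp K p e * ghostOp K p e = vertexOp K p x :=
  end_ext K fun q k => by
    rw [LinearMap.sum_apply, vertexOp_single]
    simp only [edgeOp_mul_ghostOp_single]
    rw [Finset.sum_ite_eq]
    simp [emitted]

/-- The left action of the unital algebra on the Chen module. -/
noncomputable def leftRep : UnitalAlgebra K V →ₐ[K] Module.End K (ChenModule K p) :=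
  RingQuot.liftAlgHom K ⟨FreeAlgebra.lift K (genOp K p), by
    intro a b h
    cases h <;> simp only [map_mul, map_sum, map_zero, FreeAlgebra.lift_ι_apply, genOp]
    · exact vertexOp_mul_self K p _
    · exact vertexOp_mul_of_ne K p ‹_›
    · exact vertexOp_mul_edgeOp K p _
    · exact edgeOp_mul_vertexOp K p _
    · exact vertexOp_mul_ghostOp K p _
    · exact ghostOp_mul_vertexOp K p _
    · exact ghostOp_mul_edgeOp_self K p _
    · exact ghostOp_mul_edgeOp_of_ne K p ‹_›
    · exact (sum_edgeOp_mul_ghostOp K p _ _).symm⟩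

theorem leftRep_gen (g : Gen V) : leftRep K p (gen K V g) = genOp K p g := by
  rw [leftRep, gen, RingQuot.liftAlgHom_mkAlgHom_apply, FreeAlgebra.lift_ι_apply]

/-- The involution of the generators exchanging edges and ghost edges. -/
def Gen.star : Gen V → Gen V
  | .vertex x => .vertex x
  | .edge e => .ghost e
  | .ghost e => .edge e

theorem Gen.star_star (g : Gen V) : g.star.star = g := by cases g <;> rfl

/-- The right action of the unital algebra on the Chen module. -/
noncomputable def rightRep : UnitalAlgebra K V →ₐ[K] (Module.End K (ChenModule K p))ᵐᵒᵖ :=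
  -- Reversing products while exchanging `e` and `e^*` permutes the defining relations, so the
  -- operator identities for the left action suffice.
  RingQuot.liftAlgHom K ⟨FreeAlgebra.lift K (fun g => MulOpposite.op (genOp K p g.star)), by
    intro a b h
    cases h <;> simp only [map_mul, map_sum, map_zero, FreeAlgebra.lift_ι_apply, genOp,
      Gen.star, ← MulOpposite.op_mul, ← Finset.op_sum, ← MulOpposite.op_zero] <;>
      refine congrArg MulOpposite.op ?_
    · exact vertexOp_mul_self K p _
    · exact vertexOp_mul_of_ne K p (Ne.symm ‹_›)
    · exact ghostOp_mul_vertexOp K p _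
    · exact vertexOp_mul_ghostOp K p _
    · exact edgeOp_mul_vertexOp K p _
    · exact vertexOp_mul_edgeOp K p _
    · exact ghostOp_mul_edgeOp_self K p _
    · exact ghostOp_mul_edgeOp_of_ne K p (Ne.symm ‹_›)
    · exact (sum_edgeOp_mul_ghostOp K p _ _).symm⟩

theorem rightRep_gen (g : Gen V) :
    rightRep K p (gen K V g) = MulOpposite.op (genOp K p g.star) := by
  rw [rightRep, gen, RingQuot.liftAlgHom_mkAlgHom_apply, FreeAlgebra.lift_ι_apply]

end Operators

/-! ### Simplicity of Chen modules -/

section Simplicity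

open scoped Classical

variable {K : Type w} [Field K] {V : Type u} [Quiver.{v} V] {p : ℕ → Quiver.Total V}

/-- The product of the ghost edges of the first `n` terms of a sequence. -/
noncomputable def prefixGhost (K : Type w) [Field K] (p s : ℕ → Quiver.Total V) :
    ℕ → Module.End K (ChenModule K p)
  | 0 => 1
  | n + 1 => ghostOp K p (s n) * prefixGhost K p s n

theorem prefixGhost_single (s : ℕ → Quiver.Total V) (n : ℕ) (q : TailClass p) (k : K) :
    prefixGhost K p s n (single q k) =
      if ∀ i < n, q.1 i = s i then single (q.drop n) k else 0 := by
  induction n with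
  | zero => simp [prefixGhost, q.drop_zero]
  | succ n ih =>
    rw [prefixGhost, Module.End.mul_apply, ih]
    by_cases h : ∀ i < n, q.1 i = s i
    · rw [if_pos h, ghostOp_single, q.drop_drop]
      refine if_congr ?_ rfl rfl
      simp only [Nat.lt_succ_iff_lt_or_eq, or_imp, forall_and, forall_eq]
      exact ⟨fun h' => ⟨h, h'⟩, fun h' => h'.2⟩
    · rw [if_neg h, map_zero, if_neg fun h' => h fun i hi => h' i (by omega)]

/-- Each member differs from `s` at some index; finiteness makes one prefix length work for all. -/
theorem exists_prefix_ne (S : Finset (TailClass p)) (s : ℕ → Quiver.Total V)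
    (hS : ∀ q ∈ S, q.1 ≠ s) : ∃ n, ∀ q ∈ S, ¬ ∀ i < n, q.1 i = s i := by
  have : ∀ᶠ n in Filter.atTop, ∀ q ∈ S, ¬ ∀ i < n, q.1 i = s i := by
    rw [Filter.eventually_all_finset]
    intro q hq
    obtain ⟨i, hi⟩ := Function.ne_iff.1 (hS q hq)
    filter_upwards [Filter.eventually_gt_atTop i] with n hn h
    exact hi (h i hn)
  exact this.exists

theorem prefixGhost_eq_zero (s : ℕ → Quiver.Total V) (n : ℕ) (x : ChenModule K p)
    (h : ∀ q ∈ x.support, ¬ ∀ i < n, q.1 i = s i) : prefixGhost K p s n x = 0 := by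
  rw [← x.sum_single, map_finsuppSum]
  exact Finset.sum_eq_zero fun q hq => by
    beta_reduce
    rw [prefixGhost_single, if_neg (h q hq)]

/-- A long enough prefix of `q` is shared by no other path in the support of `x`, so its ghost edges
isolate one coefficient. -/
theorem exists_prefixGhost_eq_single (x : ChenModule K p) (q : TailClass p) :
    ∃ n, prefixGhost K p q.1 n x = single (q.drop n) (x q) := by
  obtain ⟨n, hn⟩ := exists_prefix_ne (x.erase q).support q.1 fun q' hq' h => by
    rw [support_erase, Finset.mem_erase] at hq'
    exact hq'.1 (Subtype.ext h)
  refine ⟨n, ?_⟩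
  conv_lhs => rw [← x.single_add_erase q]
  rw [map_add, prefixGhost_eq_zero _ _ _ hn, prefixGhost_single, if_pos fun _ _ => rfl, add_zero]

/-- The Chen modules are simple, in terms of the operators. -/
theorem eq_bot_or_top_of_genOp_mem (N : AddSubgroup (ChenModule K p))
    (hN : ∀ (k : K) (g : Gen V), ∀ x ∈ N, k • genOp K p g x ∈ N) : N = ⊥ ∨ N = ⊤ := by
  refine or_iff_not_imp_left.2 fun hne => ?_
  have hgen : ∀ (g : Gen V), ∀ x ∈ N, genOp K p g x ∈ N := fun g x hx => by
    simpa using hN 1 g x hx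
  obtain ⟨x, hx, hx0⟩ := N.bot_or_exists_ne_zero.resolve_left hne
  obtain ⟨q₀, hq₀⟩ := Finsupp.ne_iff.1 hx0
  rw [Finsupp.zero_apply] at hq₀
  obtain ⟨n, hn⟩ := exists_prefixGhost_eq_single x q₀
  have hpre : ∀ m, prefixGhost K p q₀.1 m x ∈ N := fun m => by
    induction m with
    | zero => exact hx
    | succ m ih => exact hgen (.ghost _) _ ih
  -- `N` is only an additive subgroup, so scalars must enter through a generator: one further ghost
  -- edge carries the factor `k * (x q₀)⁻¹`.
  have hsingle : ∃ q : TailClass p, ∀ k : K, single q k ∈ N := by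
    refine ⟨(q₀.drop n).drop 1, fun k => ?_⟩
    have := hN (k * (x q₀)⁻¹) (.ghost ((q₀.drop n).1 0)) _ (hn ▸ hpre n)
    rwa [genOp, ghostOp_single, if_pos rfl, smul_single, smul_eq_mul, mul_assoc,
      inv_mul_cancel₀ hq₀, mul_one] at this
  obtain ⟨q₁, hq₁⟩ := hsingle
  have hdrop : ∀ (q : TailClass p) (k : K) (m : ℕ), single q k ∈ N → single (q.drop m) k ∈ N := by
    intro q k m h
    induction m with
    | zero => rwa [q.drop_zero]
    | succ m ih =>
      have := hgen (.ghost ((q.drop m).1 0)) _ ih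
      rwa [genOp, ghostOp_single, if_pos rfl, q.drop_drop] at this
  have hundrop : ∀ (q : TailClass p) (k : K) (m : ℕ),
      single (q.drop m) k ∈ N → single q k ∈ N := by
    intro q k m h
    induction m with
    | zero => rwa [q.drop_zero] at h
    | succ m ih =>
      refine ih ?_
      rw [← q.drop_drop] at h
      have := hgen (.edge ((q.drop m).1 0)) _ h
      rwa [genOp, edgeOp_single, dif_pos (q.drop m).right_eq_left_drop,
        TailClass.cons_drop] at this
  refine (AddSubgroup.eq_top_iff' N).2 fun y => ?_
  induction y using Finsupp.induction_linear with
  | zero => exact N.zero_mem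
  | add f g hf hg => exact N.add_mem hf hg
  | single q k =>
    -- Any basis path is reached from `q₁` by descending to a common tail and prepending edges
    -- again.
    obtain ⟨m, l, hml⟩ := q.2.2.trans q₁.2.2.symm
    refine hundrop q k m ?_
    have : q.drop m = q₁.drop l := TailClass.ext hml
    rw [this]
    exact hdrop q₁ k l (hq₁ k)

end Simplicity

/-! ### Isomorphism classes and tail classes -/

section CountableClasses

variable {K : Type w} [Field K] {V : Type u} [Quiver.{v} V]
  {R : Type max u v w} [NonUnitalRing R]

/-- The Chen module of an infinite path as a simple module over a ring whose action realizes all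
multiples of the operators of the generators. -/
noncomputable def chenSimple (p : ℕ → Quiver.Total V) (hp : IsInfinitePath p)
    (σ : R →ₙ+* AddMonoid.End (ChenModule K p)) (t : K → Gen V → R)
    (hσ : ∀ k g x, σ (t k g) x = k • genOp K p g x) : SimpleModule R where
  carrier := ChenModule K p
  action := σ
  action_ne_zero := by
    let q : TailClass p := ⟨p, hp, TailEq.refl p⟩
    refine ⟨t 1 (.ghost (p 0)), single q 1, ?_⟩
    rw [hσ, one_smul, genOp, ghostOp_single, if_pos rfl]
    exact single_ne_zero.2 one_ne_zero
  eq_bot_or_top N hN := eq_bot_or_top_of_genOp_mem N fun k g x hx => by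
    rw [← hσ]
    exact hN _ x hx

/-- An additive map between Chen modules commuting with the ghost edges can be injective only if
the paths are tail equivalent. -/
theorem tailEq_of_injective {p p' : ℕ → Quiver.Total V} (hp : IsInfinitePath p)
    (f : ChenModule K p →+ ChenModule K p') (hf : Function.Injective f)
    (hcomm : ∀ e x, f (ghostOp K p e x) = ghostOp K p' e (f x)) : TailEq p p' := by
  by_contra hne
  have hpre : ∀ n x, f (prefixGhost K p p n x) = prefixGhost K p' p n (f x) := fun n x => by
    induction n with
    | zero => rfl
    | succ n ih => simp only [prefixGhost, Module.End.mul_apply, hcomm, ih]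
  let q : TailClass p := ⟨p, hp, TailEq.refl p⟩
  -- If `p` is not tail equivalent to `p'`, it is not a basis path of the target, so a long prefix
  -- of ghosts kills the image of `q` but not `q` itself.
  obtain ⟨n, hn⟩ := exists_prefix_ne (f (single q 1)).support p
    fun q' _ h => hne (h ▸ q'.2.2)
  have h₁ := hpre n (single q 1)
  rw [prefixGhost_eq_zero _ _ _ hn, prefixGhost_single, if_pos fun _ _ => rfl,
    map_eq_zero_iff f hf] at h₁
  exact one_ne_zero (single_eq_zero.1 h₁)

/-- If a ring with countably many simple modules acts on all Chen modules, realizing all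
multiples of the operators of the generators, then any family of infinite paths has a countable
quotient by tail equivalence. -/
theorem exists_tailEq_classifier (hR : LeftCIRT R)
    (σ : ∀ p : ℕ → Quiver.Total V, R →ₙ+* AddMonoid.End (ChenModule K p)) (t : K → Gen V → R)
    (hσ : ∀ p k g x, σ p (t k g) x = k • genOp K p g x)
    {ι : Type*} (P : ι → ℕ → Quiver.Total V) (hP : ∀ i, IsInfinitePath (P i)) :
    ∃ (C : Type max (u + 1) (v + 1) (w + 1)) (_ : Countable C) (F : ι → C),
      ∀ i j, F i = F j → TailEq (P i) (P j) := by
  refine ⟨_, hR, fun i => Quotient.mk _ (chenSimple (P i) (hP i) (σ (P i)) t (hσ (P i))), ?_⟩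
  intro i j hij
  obtain ⟨f, hf⟩ := Quotient.exact hij
  let f' : ChenModule K (P i) ≃+ ChenModule K (P j) := f
  have hf' : ∀ a x, f' (σ (P i) a x) = σ (P j) a (f' x) := hf
  refine tailEq_of_injective (hP i) f'.toAddMonoidHom f'.injective fun e x => ?_
  have := hf' (t 1 (.ghost e)) x
  rwa [hσ, hσ, one_smul, one_smul] at this

end CountableClasses

end LeavittPath

namespace LeavittPath

/-! ### Counting concatenations of two words -/

section Words

variable {α : Type*}

/-- The sequence obtained by concatenating words of length `N`, chosen by `ω` among two. -/
def wordSeq (a b : List α) (N : ℕ) (ha : a.length = N) (hb : b.length = N) (hN : 0 < N)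
    (ω : ℕ → Bool) (n : ℕ) : α :=
  if ω (n / N) then a[n % N]'((Nat.mod_lt n hN).trans_eq ha.symm) else b[n % N]'((Nat.mod_lt n hN).trans_eq hb.symm)

/-- Distinct words of equal length differ at some position, so a block reveals its bit. -/
theorem eq_of_wordSeq_eq {a b : List α} {N : ℕ} (ha : a.length = N) (hb : b.length = N)
    (hN : 0 < N) (hab : a ≠ b) {ω ω' : ℕ → Bool} (k : ℕ)
    (h : ∀ j < N, wordSeq a b N ha hb hN ω (k * N + j) = wordSeq a b N ha hb hN ω' (k * N + j)) :
    ω k = ω' k := by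
  have key : ∀ j, (hj : j < N) → (if ω k then a[j] else b[j]) = if ω' k then a[j] else b[j] := by
    intro j hj
    have := h j hj
    have hdiv : (k * N + j) / N = k := by
      rw [add_comm, Nat.add_mul_div_right _ _ hN, Nat.div_eq_of_lt hj, zero_add]
    have hmod : (k * N + j) % N = j := by
      rw [add_comm, Nat.add_mul_mod_self_right, Nat.mod_eq_of_lt hj]
    simpa only [wordSeq, hdiv, hmod] using this
  by_contra hne
  refine hab (List.ext_getElem (ha.trans hb.symm) fun j h₁ h₂ => ?_)
  have := key j (ha ▸ h₁)
  cases h₁ : ω k <;> cases h₂ : ω' k <;> simp_all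

/-- A tail class contains only countably many concatenations of two distinct words. -/
theorem countable_tailEq_wordSeq {a b : List α} {N : ℕ} (ha : a.length = N) (hb : b.length = N)
    (hN : 0 < N) (hab : a ≠ b) (p : ℕ → α) :
    {ω : ℕ → Bool | TailEq (wordSeq a b N ha hb hN ω) p}.Countable := by
  choose m n hmn using fun ω : {ω : ℕ → Bool | TailEq (wordSeq a b N ha hb hN ω) p} => ω.2
  -- The two offsets fix the sequence from position `m` on; the first `m` bits cover every block not
  -- wholly inside that tail.
  let code : {ω : ℕ → Bool | TailEq (wordSeq a b N ha hb hN ω) p} →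
      (Σ l : ℕ, ℕ × (Fin l → Bool)) := fun ω => ⟨m ω, n ω, fun i => ω.1 i⟩
  refine Function.Injective.countable (f := code) fun ω ω' h => Subtype.ext (funext fun k => ?_)
  have hm : m ω = m ω' := congrArg Sigma.fst h
  have hn : n ω = n ω' := congrArg (fun c => c.2.1) h
  by_cases hk : k < m ω
  · have hcode : ∀ c c' : (Σ l : ℕ, ℕ × (Fin l → Bool)), c = c' → ∀ (h₁ : k < c.1)
        (h₂ : k < c'.1), c.2.2 ⟨k, h₁⟩ = c'.2.2 ⟨k, h₂⟩ := by
      rintro c _ rfl _ _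
      rfl
    exact hcode _ _ h hk (hk.trans_eq hm)
  · refine eq_of_wordSeq_eq ha hb hN hab k fun j _ => ?_
    have hle : m ω ≤ k * N + j :=
      (not_lt.1 hk).trans ((Nat.le_mul_of_pos_right k hN).trans (Nat.le_add_right _ _))
    obtain ⟨i, hi⟩ := Nat.exists_eq_add_of_le hle
    rw [hi, hmn ω i, hm, hmn ω' i, hn]

/-- Each fibre of `F` lies in one tail class, hence is countable; countably many fibres cannot cover
the binary sequences, by Cantor's diagonal argument. -/
theorem not_countable_classifier {a b : List α} {N : ℕ} (ha : a.length = N) (hb : b.length = N)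
    (hN : 0 < N) (hab : a ≠ b) {C : Type*} [Countable C] (F : (ℕ → Bool) → C) :
    ¬ ∀ ω ω', F ω = F ω' →
      TailEq (wordSeq a b N ha hb hN ω) (wordSeq a b N ha hb hN ω') := by
  intro h
  have hcount : (Set.univ : Set (ℕ → Bool)).Countable := by
    have : (Set.univ : Set (ℕ → Bool)) = ⋃ c : C, F ⁻¹' {c} := by
      ext ω; simp
    rw [this]
    refine Set.countable_iUnion fun c => ?_
    rcases (F ⁻¹' {c}).eq_empty_or_nonempty with he | ⟨ω₀, h₀⟩
    · rw [he]; exact Set.countable_empty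
    · exact (countable_tailEq_wordSeq ha hb hN hab _).mono fun ω hω =>
        h ω ω₀ (Eq.trans hω (Eq.symm h₀))
  have := Set.countable_univ_iff.1 hcount
  obtain ⟨f, hf⟩ := exists_surjective_nat (ℕ → Bool)
  obtain ⟨n, hn⟩ := hf fun n => !f n n
  exact Bool.not_ne_self (f n n) (congrFun hn n).symm

end Words

/-! ### Closed paths and rotations of cycles -/

section ClosedPaths

variable {V : Type u} [Quiver.{v} V]

/-- A path of positive length from `x` to `x`. -/
def IsClosedAt (x : V) (l : List (Quiver.Total V)) : Prop :=
  IsPath l ∧ (∀ e ∈ l.head?, e.left = x) ∧ ∀ e ∈ l.getLast?, e.right = x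

theorem IsClosedAt.append {x : V} {a b : List (Quiver.Total V)} (ha : IsClosedAt x a)
    (hb : IsClosedAt x b) : IsClosedAt x (a ++ b) := by
  obtain ⟨⟨ha₀, ha₁⟩, ha₂, ha₃⟩ := ha
  obtain ⟨⟨hb₀, hb₁⟩, hb₂, hb₃⟩ := hb
  refine ⟨⟨by simp [ha₀], List.isChain_append.2 ⟨ha₁, hb₁, fun e he f hf => ?_⟩⟩, ?_, ?_⟩
  · rw [ha₃ e he, hb₂ f hf]
  · rwa [List.head?_append_of_ne_nil _ ha₀]
  · rwa [List.getLast?_append_of_ne_nil _ hb₀]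

theorem isInfinitePath_wordSeq {x : V} {a b : List (Quiver.Total V)} {N : ℕ}
    (ha : a.length = N) (hb : b.length = N) (hN : 0 < N) (hca : IsClosedAt x a)
    (hcb : IsClosedAt x b) (ω : ℕ → Bool) : IsInfinitePath (wordSeq a b N ha hb hN ω) := by
  have hword : ∀ k, ∃ l : List (Quiver.Total V), ∃ hl : l.length = N, IsClosedAt x l ∧
      ∀ j (hj : j < N), wordSeq a b N ha hb hN ω (j + k * N) = l[j] := by
    intro k
    refine ⟨if ω k then a else b, by split_ifs <;> assumption, by split_ifs <;> assumption,
      fun j hj => ?_⟩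
    have hdiv : (j + k * N) / N = k := by
      rw [Nat.add_mul_div_right _ _ hN, Nat.div_eq_of_lt hj, zero_add]
    have hmod : (j + k * N) % N = j := by
      rw [Nat.add_mul_mod_self_right, Nat.mod_eq_of_lt hj]
    simp only [wordSeq, hdiv, hmod]
    split_ifs <;> rfl
  intro n
  obtain ⟨l, hl, hcl, h⟩ := hword (n / N)
  have hn : n % N + n / N * N = n := Nat.mod_add_div' n N
  have hlt := Nat.mod_lt n hN
  have h₀ := h (n % N) hlt
  rw [hn] at h₀
  rw [h₀]
  -- Consecutive edges lie either within one word or across a junction, where both words are based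
  -- at `x`.
  by_cases hlast : n % N + 1 < N
  · have h₁ := h (n % N + 1) hlast
    rw [add_right_comm, hn] at h₁
    rw [h₁]
    exact List.isChain_iff_getElem.1 hcl.1.2 (n % N) (hl ▸ hlast)
  · obtain ⟨l', hl', hcl', h'⟩ := hword (n / N + 1)
    have h₁ := h' 0 hN
    have hN' : n % N + 1 = N := by omega
    have : 0 + (n / N + 1) * N = n + 1 := by
      rw [add_mul, one_mul, zero_add]
      omega
    rw [this] at h₁
    rw [h₁, hcl'.2.1 _ (by rw [List.head?_eq_getElem?, List.getElem?_eq_getElem]; rfl)]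
    refine hcl.2.2 _ ?_
    have hi : l.length - 1 = n % N := by omega
    simp only [List.getLast?_eq_getElem?, hi, List.getElem?_eq_getElem (hlt.trans_eq hl.symm)]
    rfl

theorem IsCycle.cycleChain {c : List (Quiver.Total V)} (hc : IsCycle c) :
    Cycle.Chain (fun e f : Quiver.Total V => e.right = f.left) (c : Cycle (Quiver.Total V)) := by
  obtain ⟨⟨h₀, h₁⟩, h₂, -⟩ := hc
  cases c with
  | nil => exact absurd rfl h₀
  | cons e l =>
    rw [Cycle.chain_coe_cons, ← List.cons_append]
    exact List.isChain_append.2 ⟨h₁, List.isChain_singleton _, fun f hf g hg =>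
      h₂ f hf g (by simpa using hg)⟩

/-- A cycle can be rotated to start at any of its vertices. -/
theorem IsCycle.exists_isClosedAt {c : List (Quiver.Total V)} (hc : IsCycle c) {x : V}
    (hx : x ∈ vertices c) :
    ∃ a, c.IsRotated a ∧ IsClosedAt x a ∧ (a.map fun e => e.left).Nodup := by
  have hchain := hc.cycleChain
  have key : ∀ (a : List (Quiver.Total V)) (e : Quiver.Total V), c.IsRotated (e :: a) →
      List.IsChain (fun e f : Quiver.Total V => e.right = f.left) (e :: a ++ [e]) := by
    intro a e h
    rw [List.cons_append, ← Cycle.chain_coe_cons, ← Cycle.coe_eq_coe.2 h]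
    exact hchain
  have hrot : ∀ e ∈ c, ∃ a, c.IsRotated (e :: a) := by
    intro e he
    obtain ⟨s, t, rfl⟩ := List.append_of_mem he
    exact ⟨t ++ s, List.isRotated_append⟩
  -- The range of an edge is the source of its cyclic successor, which is the edge itself for a
  -- loop.
  have hleft : ∃ e ∈ c, x = e.left := by
    obtain ⟨e, he, rfl | rfl⟩ := hx
    · exact ⟨e, he, rfl⟩
    · obtain ⟨a, ha⟩ := hrot e he
      have h := key a e ha
      cases a with
      | nil => exact ⟨e, he, (List.isChain_cons_cons.1 h).1⟩
      | cons f a =>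
        exact ⟨f, ha.mem_iff.2 (by simp), (List.isChain_cons_cons.1 h).1⟩
  obtain ⟨e, he, rfl⟩ := hleft
  obtain ⟨a, ha⟩ := hrot e he
  obtain ⟨h₁, -, h₂⟩ := List.isChain_append.1 (key a e ha)
  refine ⟨e :: a, ha, ⟨⟨List.cons_ne_nil _ _, h₁⟩, ?_, fun f hf => h₂ f hf e rfl⟩,
    ((ha.perm.map _).nodup_iff).1 hc.2.2⟩
  rintro f ⟨⟩
  rfl

/-- A closed path that is a prefix of a closed path visiting its base only once is equal to it. -/
theorem IsClosedAt.eq_of_prefix {x : V} {a b : List (Quiver.Total V)} (ha : IsClosedAt x a)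
    (hb : IsClosedAt x b) (hnd : (b.map fun e => e.left).Nodup) (h : a <+: b) : a = b := by
  obtain ⟨t, rfl⟩ := h
  cases t with
  | nil => rw [List.append_nil]
  | cons g t =>
    -- The first edge `g` of a nonempty remainder would start at `x`, repeating the source of the
    -- first edge of `a`.
    exfalso
    have h₁ := (List.isChain_append.1 hb.1.2).2.2 _ (List.getLast?_eq_getLast_of_ne_nil ha.1.1) g rfl
    rw [ha.2.2 _ (List.getLast?_eq_getLast_of_ne_nil ha.1.1)] at h₁
    rw [List.map_append, List.nodup_append] at hnd
    cases a with
    | nil => exact ha.1.1 rfl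
    | cons e a => exact hnd.2.2 e.left (by simp) g.left (by simp) ((ha.2.1 e rfl).trans h₁)

end ClosedPaths

/-! ### Left and right actions of the Leavitt path algebra -/

section Actions

variable (K : Type w) [Field K] {V : Type u} [Quiver.{v} V] (p : ℕ → Quiver.Total V)

/-- Linear endomorphisms as additive endomorphisms. -/
def endToAddMonoidEnd (M : Type*) [AddCommGroup M] [Module K M] :
    Module.End K M →+* AddMonoid.End M where
  toFun f := f.toAddMonoidHom
  map_one' := rfl
  map_mul' _ _ := rfl
  map_zero' := rfl
  map_add' _ _ := rfl

/-- The multiple of a generator by a scalar in the Leavitt path algebra. -/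
def scaledGen (k : K) (g : Gen V) : leavittPathAlgebra K V :=
  k • ⟨gen K V g, NonUnitalAlgebra.subset_adjoin K ⟨g, rfl⟩⟩

/-- The left action of the Leavitt path algebra on a Chen module. -/
noncomputable def leftAction :
    leavittPathAlgebra K V →ₙ+* AddMonoid.End (ChenModule K p) where
  toFun a := endToAddMonoidEnd K _ (leftRep K p a)
  map_mul' a b := by simp
  map_zero' := by simp
  map_add' a b := by simp

theorem leftAction_scaledGen (k : K) (g : Gen V) (x : ChenModule K p) :
    leftAction K p (scaledGen K k g) x = k • genOp K p g x := by
  change leftRep K p (k • gen K V g) x = _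
  rw [map_smul, leftRep_gen]
  rfl

/-- The right action of the Leavitt path algebra on a Chen module. -/
noncomputable def rightAction :
    (leavittPathAlgebra K V)ᵐᵒᵖ →ₙ+* AddMonoid.End (ChenModule K p) where
  toFun a := endToAddMonoidEnd K _ (rightRep K p a.unop).unop
  map_mul' a b := by simp
  map_zero' := by simp
  map_add' a b := by simp

theorem rightAction_scaledGen (k : K) (g : Gen V) (x : ChenModule K p) :
    rightAction K p (MulOpposite.op (scaledGen K k g.star)) x = k • genOp K p g x := by
  change (rightRep K p (k • gen K V g.star)).unop x = _
  rw [map_smul, rightRep_gen, g.star_star]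
  rfl

/-- Tail equivalence is refined by a map to a countable set when there are countably many simple
left or right modules. -/
theorem exists_tailEq_classifier_of_CIRT {ι : Type*}
    (h : LeftCIRT (leavittPathAlgebra K V) ∨ RightCIRT (leavittPathAlgebra K V))
    (P : ι → ℕ → Quiver.Total V) (hP : ∀ i, IsInfinitePath (P i)) :
    ∃ (C : Type max (u + 1) (v + 1) (w + 1)) (_ : Countable C) (F : ι → C),
      ∀ i j, F i = F j → TailEq (P i) (P j) := by
  rcases h with h | h
  · exact exists_tailEq_classifier h (leftAction K) (scaledGen K) (leftAction_scaledGen K) P hP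
  · exact exists_tailEq_classifier h (rightAction K)
      (fun k g => MulOpposite.op (scaledGen K k g.star)) (rightAction_scaledGen K) P hP

end Actions

end LeavittPath

/-- If the Leavitt path algebra has at most countably many isomorphism classes of simple left
modules, or of simple right modules, then distinct cycles of the graph (cycles being identified
up to the choice of the base vertex) have no common vertex. -/
theorem proposition3p1 (K : Type w) [Field K] (V : Type u) [Quiver.{v} V]
    (hCIRT : LeavittPath.LeftCIRT (LeavittPath.leavittPathAlgebra K V) ∨
      LeavittPath.RightCIRT (LeavittPath.leavittPathAlgebra K V))
    (c d : List (Quiver.Total V))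
    (hc : LeavittPath.IsCycle c) (hd : LeavittPath.IsCycle d)
    (hcd : ¬ c.IsRotated d) :
    Disjoint (LeavittPath.vertices c) (LeavittPath.vertices d) := by
  refine Set.disjoint_left.2 fun x hxc hxd => ?_
  obtain ⟨a, hca, ha, hna⟩ := hc.exists_isClosedAt hxc
  obtain ⟨b, hdb, hb, hnb⟩ := hd.exists_isClosedAt hxd
  have hab : a ≠ b := fun h => hcd (hca.trans (h ▸ hdb.symm))
  -- `a` and `b` may differ in length, whereas `ab` and `ba` do not. If these agreed, one of `a`,
  -- `b` would be a prefix of the other.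
  have hne : a ++ b ≠ b ++ a := fun h => by
    rcases List.prefix_or_prefix_of_prefix (List.prefix_append a b)
      (h ▸ List.prefix_append b a) with h' | h'
    · exact hab (ha.eq_of_prefix hb hnb h')
    · exact hab (hb.eq_of_prefix ha hna h').symm
  have hN : 0 < (a ++ b).length := List.length_pos_iff.2 (ha.append hb).1.1
  have hlen : (b ++ a).length = (a ++ b).length := by simp [add_comm]
  obtain ⟨C, _, F, hF⟩ := LeavittPath.exists_tailEq_classifier_of_CIRT K hCIRT _
    (LeavittPath.isInfinitePath_wordSeq rfl hlen hN (ha.append hb) (hb.append ha))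
  exact LeavittPath.not_countable_classifier rfl hlen hN hne F hF
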